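/- Let $r\in\mathbb{N}$ and let $M_r(\mathbb{C})$ be the algebra of complex $r\times r$ matrices. For $T\in M_r(\mathbb{C})$ let $|T|=(T^*T)^{1/2}$ and let $T=U|T|$ be the polar decomposition of $T$, where $U$ is the partial isometry with $\ker U=\ker T$. The Aluthge transform of $T$ is $$\Delta(T)=|T|^{1/2}\,U\,|T|^{1/2},$$ and its iterates are $\Delta^0(T)=T$ and $\Delta^n(T)=\Delta(\Delta^{n-1}(T))$ for $n\ge 1$. Theorem. If $T\in M_r(\mathbb{C})$ is diagonalizable (that is, similar to a diagonal matrix), then the sequence $\{\Delta^n(T)\}_{n\in\mathbb{N}}$ converges in $M_r(\mathbb{C})$. -/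

import Mathlib

open Filter Topology
open scoped MatrixOrder ComplexOrder

/-- `T` is diagonalizable: it is similar to a diagonal matrix. -/
def IsDiagonalizableMatrix {r : ℕ} (T : Matrix (Fin r) (Fin r) ℂ) : Prop :=
  ∃ (S : Matrix (Fin r) (Fin r) ℂ) (d : Fin r → ℂ),
    IsUnit S ∧ T = S * Matrix.diagonal d * S⁻¹

/-- `T = U |T|` is the polar decomposition of `T`, where `|T| = (T* T)^{1/2}`:
`U` is a partial isometry whose kernel is the kernel of `T`. -/
structure IsPolarDecomposition {r : ℕ} (T U : Matrix (Fin r) (Fin r) ℂ) : Prop where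
  eq_mul_abs : T = U * CFC.abs T
  partial_isometry : U * U.conjTranspose * U = U
  ker_eq : ∀ v : Fin r → ℂ, U.mulVec v = 0 ↔ T.mulVec v = 0

/-- The partial isometry `U` of the polar decomposition `T = U |T|`, namely `T |T|⁺`, where the
pseudo-inverse `|T|⁺` of `|T|` inverts the nonzero eigenvalues and keeps the eigenvalue zero
(in Lean, `0⁻¹ = 0`). See `isPolarDecomposition_iff`. -/
noncomputable def polarFactor {r : ℕ} (T : Matrix (Fin r) (Fin r) ℂ) :
    Matrix (Fin r) (Fin r) ℂ :=
  T * cfc (fun x : ℝ => x⁻¹) (CFC.abs T)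

/-- The Aluthge transform `|T|^{1/2} U |T|^{1/2}` of `T`, with `T = U |T|` the polar
decomposition of `T`. -/
noncomputable def aluthge {r : ℕ} (T : Matrix (Fin r) (Fin r) ℂ) :
    Matrix (Fin r) (Fin r) ℂ :=
  CFC.sqrt (CFC.abs T) * polarFactor T * CFC.sqrt (CFC.abs T)

theorem abs_mul_abs_matrix {r : ℕ} (T : Matrix (Fin r) (Fin r) ℂ) :
    CFC.abs T * CFC.abs T = T.conjTranspose * T :=
  CFC.abs_mul_abs T

theorem conjTranspose_abs_matrix {r : ℕ} (T : Matrix (Fin r) (Fin r) ℂ) :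
    (CFC.abs T).conjTranspose = CFC.abs T :=
  (CFC.abs_nonneg T).isSelfAdjoint

theorem mul_eq_zero_of_mul_abs_eq_zero {r : ℕ} {T X : Matrix (Fin r) (Fin r) ℂ}
    (h : X * CFC.abs T = 0) : X * T.conjTranspose = 0 := by
  rw [← Matrix.self_mul_conjTranspose_eq_zero, Matrix.conjTranspose_mul,
    Matrix.conjTranspose_conjTranspose]
  have : X * T.conjTranspose * (T * X.conjTranspose)
      = X * (T.conjTranspose * T) * X.conjTranspose := by simp only [Matrix.mul_assoc]
  rw [this, ← abs_mul_abs_matrix, ← Matrix.mul_assoc, h]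
  simp

theorem abs_pinv_abs {r : ℕ} (T : Matrix (Fin r) (Fin r) ℂ) :
    CFC.abs T * cfc (fun x : ℝ => x⁻¹) (CFC.abs T) * CFC.abs T = CFC.abs T := by
  have hsa : IsSelfAdjoint (CFC.abs T) := (CFC.abs_nonneg T).isSelfAdjoint
  have hfin : (spectrum ℝ (CFC.abs T)).Finite := Matrix.finite_real_spectrum
  have hc : ∀ f : ℝ → ℝ, ContinuousOn f (spectrum ℝ (CFC.abs T)) := fun f => hfin.continuousOn f
  conv_lhs => enter [2]; rw [← cfc_id' ℝ (CFC.abs T)]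
  conv_lhs => enter [1, 1]; rw [← cfc_id' ℝ (CFC.abs T)]
  rw [← cfc_mul _ _ _ (hc _) (hc _), ← cfc_mul _ _ _ (hc _) (hc _)]
  conv_rhs => rw [← cfc_id' ℝ (CFC.abs T)]
  congr 1
  funext x
  by_cases hx : x = 0 <;> simp [hx]

theorem pinv_abs_pinv {r : ℕ} (T : Matrix (Fin r) (Fin r) ℂ) :
    cfc (fun x : ℝ => x⁻¹) (CFC.abs T) * CFC.abs T * cfc (fun x : ℝ => x⁻¹) (CFC.abs T)
      = cfc (fun x : ℝ => x⁻¹) (CFC.abs T) := by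
  have hsa : IsSelfAdjoint (CFC.abs T) := (CFC.abs_nonneg T).isSelfAdjoint
  have hfin : (spectrum ℝ (CFC.abs T)).Finite := Matrix.finite_real_spectrum
  have hc : ∀ f : ℝ → ℝ, ContinuousOn f (spectrum ℝ (CFC.abs T)) := fun f => hfin.continuousOn f
  conv_lhs => enter [1, 2]; rw [← cfc_id' ℝ (CFC.abs T)]
  rw [← cfc_mul _ _ _ (hc _) (hc _), ← cfc_mul _ _ _ (hc _) (hc _)]
  congr 1
  funext x
  by_cases hx : x = 0 <;> simp [hx]

theorem abs_pinv_comm {r : ℕ} (T : Matrix (Fin r) (Fin r) ℂ) :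
    CFC.abs T * cfc (fun x : ℝ => x⁻¹) (CFC.abs T)
      = cfc (fun x : ℝ => x⁻¹) (CFC.abs T) * CFC.abs T :=
  ((Commute.refl (CFC.abs T)).cfc_real (fun x : ℝ => x⁻¹)).symm.eq

theorem conjTranspose_pinv_matrix {r : ℕ} (T : Matrix (Fin r) (Fin r) ℂ) :
    (cfc (fun x : ℝ => x⁻¹) (CFC.abs T)).conjTranspose
      = cfc (fun x : ℝ => x⁻¹) (CFC.abs T) :=
  IsSelfAdjoint.cfc (f := fun x : ℝ => x⁻¹) (a := CFC.abs T)

theorem polarFactor_mul_abs {r : ℕ} (T : Matrix (Fin r) (Fin r) ℂ) :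
    polarFactor T * CFC.abs T = T := by
  have h := mul_eq_zero_of_mul_abs_eq_zero (T := T)
    (X := CFC.abs T * cfc (fun x : ℝ => x⁻¹) (CFC.abs T) - 1)
    (by rw [Matrix.sub_mul, abs_pinv_abs, Matrix.one_mul, sub_self])
  have h2 := congrArg Matrix.conjTranspose h
  have hQ := conjTranspose_pinv_matrix T
  simp only [Matrix.conjTranspose_mul, Matrix.conjTranspose_sub, Matrix.conjTranspose_one,
    Matrix.conjTranspose_conjTranspose, conjTranspose_abs_matrix, hQ,
    Matrix.conjTranspose_zero, Matrix.mul_sub, Matrix.mul_one] at h2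
  rw [polarFactor, Matrix.mul_assoc]
  exact sub_eq_zero.mp h2

theorem isPolarDecomposition_polarFactor {r : ℕ} (T : Matrix (Fin r) (Fin r) ℂ) :
    IsPolarDecomposition T (polarFactor T) := by
  have hQ := conjTranspose_pinv_matrix T
  have hcomm := abs_pinv_comm T
  have hPQP := abs_pinv_abs T
  have hTP := polarFactor_mul_abs T
  have hQPQ := pinv_abs_pinv T
  have hPP := abs_mul_abs_matrix T
  have hU : polarFactor T = T * cfc (fun x : ℝ => x⁻¹) (CFC.abs T) := rfl
  generalize cfc (fun x : ℝ => x⁻¹) (CFC.abs T) = Q at *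
  generalize CFC.abs T = P at *
  have e : (polarFactor T).conjTranspose * polarFactor T = P * Q := by
    have e1 : (polarFactor T).conjTranspose * polarFactor T
        = Q * (T.conjTranspose * T) * Q := by
      rw [hU, Matrix.conjTranspose_mul, hQ]
      simp only [Matrix.mul_assoc]
    rw [e1, ← hPP, ← Matrix.mul_assoc, ← hcomm, hPQP]
  have hker : ∀ v : Fin r → ℂ, (polarFactor T).mulVec v = 0 ↔ T.mulVec v = 0 := by
    refine fun v => ⟨fun h => ?_, fun h => ?_⟩
    · have h1 : (Q * P).mulVec v = 0 := by
        rw [← hcomm, ← e, ← Matrix.mulVec_mulVec, h, Matrix.mulVec_zero]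
      rw [← hTP, ← hPQP, Matrix.mul_assoc P, ← Matrix.mul_assoc, ← Matrix.mulVec_mulVec, h1,
        Matrix.mulVec_zero]
    · have h1 : P.mulVec v = 0 := by
        have e2 : P = Q * T.conjTranspose * T := by
          rw [Matrix.mul_assoc, ← hPP, ← Matrix.mul_assoc, ← hcomm, hPQP]
        rw [e2, ← Matrix.mulVec_mulVec, h, Matrix.mulVec_zero]
      rw [hU, ← hQPQ, Matrix.mul_assoc, hcomm, ← Matrix.mul_assoc, ← Matrix.mul_assoc,
        ← Matrix.mulVec_mulVec, h1, Matrix.mulVec_zero]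
  refine ⟨(polarFactor_mul_abs T).symm, ?_, hker⟩
  rw [Matrix.mul_assoc, e, ← Matrix.mul_assoc, hTP, hU]

/-- The polar decomposition exists and is unique, and `polarFactor` is its partial isometry. -/
theorem isPolarDecomposition_iff {r : ℕ} (T U : Matrix (Fin r) (Fin r) ℂ) :
    IsPolarDecomposition T U ↔ U = polarFactor T := by
  refine ⟨fun h => ?_, fun h => h ▸ isPolarDecomposition_polarFactor T⟩
  have h0 : T * (1 - CFC.abs T * cfc (fun x : ℝ => x⁻¹) (CFC.abs T)) = 0 := by
    have e : T * CFC.abs T * cfc (fun x : ℝ => x⁻¹) (CFC.abs T)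
        = polarFactor T * CFC.abs T * CFC.abs T * cfc (fun x : ℝ => x⁻¹) (CFC.abs T) := by
      rw [polarFactor_mul_abs]
    rw [Matrix.mul_sub, Matrix.mul_one, ← Matrix.mul_assoc, e, Matrix.mul_assoc _ (CFC.abs T),
      abs_pinv_comm, Matrix.mul_assoc, ← Matrix.mul_assoc (CFC.abs T), abs_pinv_abs,
      polarFactor_mul_abs, sub_self]
  have h1 : U * (1 - CFC.abs T * cfc (fun x : ℝ => x⁻¹) (CFC.abs T)) = 0 := by
    refine Matrix.ext_of_mulVec_single fun i => ?_
    rw [Matrix.zero_mulVec, ← Matrix.mulVec_mulVec, h.ker_eq, Matrix.mulVec_mulVec, h0,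
      Matrix.zero_mulVec]
  rw [Matrix.mul_sub, Matrix.mul_one, ← Matrix.mul_assoc, ← h.eq_mul_abs, sub_eq_zero] at h1
  exact h1

/-- Any factorization `T = U |T|`, with `U` a partial isometry or a unitary, gives the same
Aluthge transform. -/
theorem aluthge_eq {r : ℕ} {T U : Matrix (Fin r) (Fin r) ℂ} (h : T = U * CFC.abs T) :
    aluthge T = CFC.sqrt (CFC.abs T) * U * CFC.sqrt (CFC.abs T) := by
  have hS : (CFC.sqrt (CFC.abs T)).conjTranspose = CFC.sqrt (CFC.abs T) :=
    (CFC.sqrt_nonneg (CFC.abs T)).isSelfAdjoint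
  have hSS : CFC.sqrt (CFC.abs T) * CFC.sqrt (CFC.abs T) = CFC.abs T :=
    CFC.sqrt_mul_sqrt_self _ (CFC.abs_nonneg T)
  have h0 : (polarFactor T - U) * CFC.sqrt (CFC.abs T) = 0 := by
    rw [← Matrix.self_mul_conjTranspose_eq_zero, Matrix.conjTranspose_mul, hS]
    have e : (polarFactor T - U) * CFC.sqrt (CFC.abs T)
          * (CFC.sqrt (CFC.abs T) * (polarFactor T - U).conjTranspose)
        = (polarFactor T - U) * (CFC.sqrt (CFC.abs T) * CFC.sqrt (CFC.abs T))
          * (polarFactor T - U).conjTranspose := by simp only [Matrix.mul_assoc]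
    rw [e, hSS, Matrix.sub_mul, polarFactor_mul_abs, ← h, sub_self, Matrix.zero_mul]
  rw [Matrix.sub_mul, sub_eq_zero] at h0
  rw [aluthge, Matrix.mul_assoc, h0, Matrix.mul_assoc]

/-!
Let `T = U P` with `P = |T|`, let `Q = U P U* = |T*|`, let `‖·‖` be the Frobenius norm, and write
`C(T) = T* T - T T* = P² - Q²`. One step of the Aluthge transform `Δ` satisfies

* `‖T‖² - ‖Δ(T)‖² = ‖P - Q‖² / 2` (`frobSq_abs_sub_absAdjoint`),
* `‖C(T)‖² ≤ 4 ‖T‖² ‖P - Q‖²`, since `2 (P² - Q²)` is the anticommutator of `P - Q` and `P + Q`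
  (`frobSq_selfCommutator_le`),
* `‖Δ(T) - T‖ ≤ ‖P - Q‖` (`frobSq_aluthge_sub_le`).

As `Δ` preserves the characteristic polynomial, `‖T‖² - ‖Δ(T)‖²` is also the decrement of the
departure from normality `f(T) = ‖T‖² - ∑ |λ|²`, so it suffices that `f` decays geometrically along
the iteration: the steps `Δ^{n+1}(T) - Δ^n(T)` are then summable.

`Δ` preserves diagonalizability too, for singular `T` as well (`aluthge_isDiagonalizableMatrix`).
A diagonalizable matrix has a Schur form `D + N` in which the strictly triangular part `N` vanishes
between equal eigenvalues (`IsDiagonalizableMatrix.exists_schur`), and `f(T) = ‖N‖²`. The diagonal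
of `C(T)` gives `f(T)² ≤ K ‖C(T)‖²` (`IsDiagonalizableMatrix.normalDefect_sq_le`), hence
`f(Δ^n(T)) → 0`. The entries of `C(T)` above the diagonal are `(conj d_i - conj d_j) n_ij` up to
terms quadratic in `N`, which gives `δ² f(T) ≤ 2 ‖C(T)‖² + 8 f(T)²`, where `δ` is a lower bound for
the distances of distinct eigenvalues (`IsDiagonalizableMatrix.sq_mul_normalDefect_le`). Once `f` is
small, the quadratic term is absorbed and each step reduces `f` by a fixed factor
(`exists_geometric_bound_of_decrement`).
-/

/-! ### Diagonalizability and annihilating polynomials -/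

theorem aeval_mul_eq_mul_aeval_of_mul_eq_mul {R A : Type*} [CommSemiring R] [Semiring A]
    [Algebra R A] {a b x : A} (h : a * x = x * b) (q : Polynomial R) :
    Polynomial.aeval a q * x = x * Polynomial.aeval b q := by
  induction q using Polynomial.induction_on with
  | C c => simp only [Polynomial.aeval_C, Algebra.commutes]
  | add p q hp hq => rw [map_add, map_add, add_mul, mul_add, hp, hq]
  | monomial n c ih =>
    rw [pow_succ, ← mul_assoc, map_mul (Polynomial.aeval a), map_mul (Polynomial.aeval b),
      Polynomial.aeval_X, Polynomial.aeval_X, mul_assoc, h, ← mul_assoc, ih, mul_assoc]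

theorem aeval_diagonal {n : Type*} [Fintype n] [DecidableEq n] (d : n → ℂ) (q : Polynomial ℂ) :
    Polynomial.aeval (Matrix.diagonal d) q = Matrix.diagonal fun i => q.eval (d i) := by
  have h := Polynomial.aeval_algHom_apply (Matrix.diagonalAlgHom (n := n) (α := ℂ) ℂ) d q
  rw [Matrix.diagonalAlgHom_apply, Matrix.diagonalAlgHom_apply] at h
  rw [h]
  congr 1
  funext i
  simp [Polynomial.aeval_def, Polynomial.eval₂_eq_eval_map]

/-- A diagonalizable matrix is annihilated by a squarefree polynomial that vanishes at `0`. The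
factor `X` is harmless when `T` is invertible, and makes the property stable under the Aluthge
transform when it is not. -/
theorem IsDiagonalizableMatrix.exists_squarefree_X_mul {r : ℕ} {T : Matrix (Fin r) (Fin r) ℂ}
    (hT : IsDiagonalizableMatrix T) :
    ∃ p : Polynomial ℂ, Squarefree (Polynomial.X * p) ∧ T * Polynomial.aeval T p = 0 := by
  obtain ⟨S, d, hS, rfl⟩ := hT
  have hdet := (Matrix.isUnit_iff_isUnit_det S).mp hS
  set s : Finset ℂ := (Finset.univ.image d).erase 0 with hs
  have hX : Polynomial.X * ∏ z ∈ s, (Polynomial.X - Polynomial.C z)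
      = ∏ z ∈ insert 0 s, (Polynomial.X - Polynomial.C z) := by
    rw [Finset.prod_insert (Finset.notMem_erase _ _), Polynomial.C_0, sub_zero]
  refine ⟨∏ z ∈ s, (Polynomial.X - Polynomial.C z), ?_, ?_⟩
  · rw [hX]
    exact (Polynomial.separable_prod_X_sub_C_iff'.mpr fun x _ y _ h => h).squarefree
  · have h1 : Polynomial.aeval (S * Matrix.diagonal d * S⁻¹)
        (Polynomial.X * ∏ z ∈ s, (Polynomial.X - Polynomial.C z)) * S = 0 := by
      rw [aeval_mul_eq_mul_aeval_of_mul_eq_mul (b := Matrix.diagonal d), aeval_diagonal, hX]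
      · have : (fun i => Polynomial.eval (d i) (∏ z ∈ insert 0 s, (Polynomial.X - Polynomial.C z)))
            = fun _ => 0 := by
          funext i
          rw [Polynomial.eval_prod]
          refine Finset.prod_eq_zero (i := d i) ?_ (by simp)
          by_cases h : d i = 0 <;> simp [hs, h]
        rw [this, Matrix.diagonal_zero, Matrix.mul_zero]
      · rw [Matrix.mul_assoc, Matrix.nonsing_inv_mul _ hdet, Matrix.mul_one]
    rw [map_mul, Polynomial.aeval_X] at h1
    exact (hS.mul_left_eq_zero).mp h1

theorem isDiagonalizableMatrix_of_squarefree {r : ℕ} {T : Matrix (Fin r) (Fin r) ℂ}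
    {q : Polynomial ℂ} (hq : Squarefree q) (hT : Polynomial.aeval T q = 0) :
    IsDiagonalizableMatrix T := by
  have h0 : Polynomial.aeval (Matrix.toLinAlgEquiv' T) q = 0 := by
    rw [Polynomial.aeval_algHom_apply (Matrix.toLinAlgEquiv' (R := ℂ) (n := Fin r)), hT, map_zero]
  have htop := (Module.End.isSemisimple_of_squarefree_aeval_eq_zero hq h0).iSup_eigenspace_eq_top
  have hspan : ⊤ ≤ Submodule.span ℂ {v : Fin r → ℂ | ∃ μ : ℂ, T.mulVec v = μ • v} := by
    rw [← htop]
    refine iSup_le fun μ v hv => Submodule.subset_span ⟨μ, ?_⟩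
    simpa [Module.End.mem_eigenspace_iff] using hv
  let b₀ := Module.Basis.ofSpan hspan
  have : Fintype ↑((linearIndepOn_empty ℂ id).extend
      (Set.empty_subset {v : Fin r → ℂ | ∃ μ : ℂ, T.mulVec v = μ • v})) :=
    FiniteDimensional.fintypeBasisIndex b₀
  let b := b₀.reindex (Fintype.equivOfCardEq (β := Fin r) (by
    rw [← Module.finrank_eq_card_basis b₀]; simp))
  have hb : ∀ i, ∃ μ : ℂ, T.mulVec (b i) = μ • b i := by
    intro i
    rw [Module.Basis.reindex_apply]
    exact Module.Basis.ofSpan_subset hspan ⟨_, rfl⟩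
  choose d hd using hb
  let S : Matrix (Fin r) (Fin r) ℂ := Matrix.of fun i j => b j i
  have hS : IsUnit S := by
    rw [← Matrix.linearIndependent_cols_iff_isUnit]
    exact b.linearIndependent
  refine ⟨S, d, hS, ?_⟩
  have hdet := (Matrix.isUnit_iff_isUnit_det S).mp hS
  have : T * S = S * Matrix.diagonal d := by
    ext i j
    have h1 : (T * S) i j = d j * S i j := congrFun (hd j) i
    rw [Matrix.mul_diagonal, h1, mul_comm]
  rw [← this, Matrix.mul_assoc, Matrix.mul_nonsing_inv _ hdet, Matrix.mul_one]

/-! ### Spectral properties preserved by the Aluthge transform -/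

theorem sqrt_abs_mul_sqrt_abs {r : ℕ} (T : Matrix (Fin r) (Fin r) ℂ) :
    CFC.sqrt (CFC.abs T) * CFC.sqrt (CFC.abs T) = CFC.abs T :=
  CFC.sqrt_mul_sqrt_self _ (CFC.abs_nonneg T)

theorem conjTranspose_sqrt_abs {r : ℕ} (T : Matrix (Fin r) (Fin r) ℂ) :
    (CFC.sqrt (CFC.abs T)).conjTranspose = CFC.sqrt (CFC.abs T) :=
  (CFC.sqrt_nonneg (CFC.abs T)).isSelfAdjoint

theorem polarFactor_mul_sqrt_mul_sqrt {r : ℕ} (T : Matrix (Fin r) (Fin r) ℂ) :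
    polarFactor T * CFC.sqrt (CFC.abs T) * CFC.sqrt (CFC.abs T) = T := by
  rw [Matrix.mul_assoc, sqrt_abs_mul_sqrt_abs, polarFactor_mul_abs]

theorem sqrt_mul_polarFactor_mul_sqrt {r : ℕ} (T : Matrix (Fin r) (Fin r) ℂ) :
    CFC.sqrt (CFC.abs T) * (polarFactor T * CFC.sqrt (CFC.abs T)) = aluthge T := by
  rw [aluthge, Matrix.mul_assoc]

theorem charpoly_aluthge {r : ℕ} (T : Matrix (Fin r) (Fin r) ℂ) :
    (aluthge T).charpoly = T.charpoly := by
  rw [← sqrt_mul_polarFactor_mul_sqrt, Matrix.charpoly_mul_comm, polarFactor_mul_sqrt_mul_sqrt]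

theorem sqrt_abs_mul_eq_zero_of_mul_eq_zero {r : ℕ} {T X : Matrix (Fin r) (Fin r) ℂ}
    (h : T * X = 0) : CFC.sqrt (CFC.abs T) * X = 0 := by
  have h1 : CFC.abs T * X = 0 := by
    rw [← Matrix.conjTranspose_mul_self_eq_zero, Matrix.conjTranspose_mul, conjTranspose_abs_matrix,
      Matrix.mul_assoc, ← Matrix.mul_assoc (CFC.abs T), abs_mul_abs_matrix, Matrix.mul_assoc, h,
      Matrix.mul_zero, Matrix.mul_zero]
  rw [← Matrix.conjTranspose_mul_self_eq_zero, Matrix.conjTranspose_mul, conjTranspose_sqrt_abs,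
    Matrix.mul_assoc, ← Matrix.mul_assoc (CFC.sqrt _), sqrt_abs_mul_sqrt_abs, h1, Matrix.mul_zero]

/-- Writing `T = B A` and `Δ(T) = A B` with `A = |T|^{1/2}`, one has `Δ(T) p(Δ(T)) = A p(T) B`,
and `A` has the same kernel as `T`; hence `T p(T) = 0` implies `Δ(T) p(Δ(T)) = 0`. -/
theorem aluthge_isDiagonalizableMatrix {r : ℕ} {T : Matrix (Fin r) (Fin r) ℂ}
    (hT : IsDiagonalizableMatrix T) : IsDiagonalizableMatrix (aluthge T) := by
  obtain ⟨p, hp, h⟩ := hT.exists_squarefree_X_mul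
  refine isDiagonalizableMatrix_of_squarefree hp ?_
  have hc : T * (polarFactor T * CFC.sqrt (CFC.abs T))
      = polarFactor T * CFC.sqrt (CFC.abs T) * aluthge T := by
    rw [← sqrt_mul_polarFactor_mul_sqrt, ← Matrix.mul_assoc (_ * _) (CFC.sqrt _),
      polarFactor_mul_sqrt_mul_sqrt]
  rw [map_mul, Polynomial.aeval_X, ← sqrt_mul_polarFactor_mul_sqrt, Matrix.mul_assoc,
    sqrt_mul_polarFactor_mul_sqrt, ← aeval_mul_eq_mul_aeval_of_mul_eq_mul hc, ← Matrix.mul_assoc,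
    sqrt_abs_mul_eq_zero_of_mul_eq_zero h, Matrix.zero_mul]

/-! ### Schur triangularization with grouped eigenvalues -/

/-- The eigenvalues can be listed so that equal ones stand next to each other: they are sorted
lexicographically by real and imaginary part. -/
theorem IsDiagonalizableMatrix.exists_grouped {r : ℕ} {T : Matrix (Fin r) (Fin r) ℂ}
    (hT : IsDiagonalizableMatrix T) :
    ∃ (S : Matrix (Fin r) (Fin r) ℂ) (d : Fin r → ℂ), IsUnit S ∧ T * S = S * Matrix.diagonal d ∧
      ∀ i k j, i ≤ k → k ≤ j → d i = d j → d k = d j := by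
  obtain ⟨S, d, hS, hTS⟩ := hT
  have hdet := (Matrix.isUnit_iff_isUnit_det S).mp hS
  have hTS' : T * S = S * Matrix.diagonal d := by
    rw [hTS, Matrix.mul_assoc, Matrix.nonsing_inv_mul _ hdet, Matrix.mul_one]
  let g : ℂ → ℝ ×ₗ ℝ := fun z => toLex (z.re, z.im)
  have hg : Function.Injective g := fun z w h => by
    have := Prod.ext_iff.mp (toLex.injective h)
    exact Complex.ext this.1 this.2
  let σ := Tuple.sort (g ∘ d)
  have hmono : Monotone ((g ∘ d) ∘ σ) := Tuple.monotone_sort _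
  refine ⟨S.submatrix id σ, d ∘ σ, ?_, ?_, fun i k j hik hkj hij => ?_⟩
  · rw [← Matrix.linearIndependent_cols_iff_isUnit] at hS ⊢
    exact hS.comp _ σ.injective
  · ext i j
    rw [Matrix.mul_diagonal]
    have := congrFun (congrFun hTS' i) (σ j)
    rwa [Matrix.mul_diagonal] at this
  · have h1 : g (d (σ i)) ≤ g (d (σ k)) := hmono hik
    have h2 : g (d (σ k)) ≤ g (d (σ j)) := hmono hkj
    have h3 : d (σ i) = d (σ j) := hij
    rw [h3] at h1
    exact hg (le_antisymm h2 h1)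

/-- QR factorization. -/
theorem exists_unitary_star_mul_isUpperTriangular {r : ℕ} (S : Matrix (Fin r) (Fin r) ℂ) :
    ∃ V ∈ Matrix.unitaryGroup (Fin r) ℂ, (star V * S).IsUpperTriangular := by
  let f : Fin r → EuclideanSpace ℂ (Fin r) := fun j => WithLp.toLp 2 fun i => S i j
  have hcard : Module.finrank ℂ (EuclideanSpace ℂ (Fin r)) = Fintype.card (Fin r) := by simp
  let b := InnerProductSpace.gramSchmidtOrthonormalBasis hcard f
  refine ⟨_, (EuclideanSpace.basisFun (Fin r) ℂ).toMatrix_orthonormalBasis_mem_unitary b,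
    fun i j hij => ?_⟩
  have h := InnerProductSpace.gramSchmidtOrthonormalBasis_inv_triangular hcard f hij
  rw [EuclideanSpace.inner_eq_star_dotProduct] at h
  rw [← h, Matrix.mul_apply, dotProduct]
  refine Finset.sum_congr rfl fun k _ => ?_
  rw [mul_comm]
  rfl

/-- Schur form of a diagonalizable matrix: with equal eigenvalues next to each other, the diagonal
blocks are diagonalizable with a single eigenvalue, hence scalar, so that the strictly upper
triangular part has no entry between equal eigenvalues. -/
theorem IsDiagonalizableMatrix.exists_schur {r : ℕ} {T : Matrix (Fin r) (Fin r) ℂ}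
    (hT : IsDiagonalizableMatrix T) :
    ∃ V ∈ Matrix.unitaryGroup (Fin r) ℂ, ∃ A : Matrix (Fin r) (Fin r) ℂ,
      T = V * A * star V ∧ A.IsUpperTriangular ∧ ∀ i j, i < j → A i i = A j j → A i j = 0 := by
  obtain ⟨S, d, hS, hTS, hd⟩ := hT.exists_grouped
  obtain ⟨V, hV, hR⟩ := exists_unitary_star_mul_isUpperTriangular S
  have hVV : V * star V = 1 := Matrix.mem_unitaryGroup_iff.mp hV
  have hVV' : star V * V = 1 := Matrix.mem_unitaryGroup_iff'.mp hV
  set R := star V * S with hRdef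
  set A := star V * T * V with hAdef
  have hAR : A * R = R * Matrix.diagonal d := by
    rw [hAdef, hRdef, Matrix.mul_assoc, ← Matrix.mul_assoc V, hVV, Matrix.one_mul,
      Matrix.mul_assoc, hTS, Matrix.mul_assoc]
  have hRu : IsUnit R := (IsUnit.of_mul_eq_one V hVV').mul hS
  have hRdet := (Matrix.isUnit_iff_isUnit_det R).mp hRu
  have hRii : ∀ i, R i i ≠ 0 := by
    rw [Matrix.det_of_isUpperTriangular hR] at hRdet
    exact fun i => Finset.prod_ne_zero_iff.mp hRdet.ne_zero i (Finset.mem_univ i)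
  have hA : A.IsUpperTriangular := by
    have : Invertible R := hRu.invertible
    have e : A = R * Matrix.diagonal d * R⁻¹ := by
      rw [← hAR, Matrix.mul_assoc, Matrix.mul_nonsing_inv _ hRdet, Matrix.mul_one]
    rw [e]
    exact (hR.mul (Matrix.blockTriangular_diagonal d)).mul
      (Matrix.blockTriangular_inv_of_blockTriangular hR)
  have hdiag : ∀ i, A i i = d i := by
    intro i
    have h := congrFun (congrFun hAR i) i
    rw [Matrix.mul_diagonal, Matrix.mul_apply, Finset.sum_eq_single i, mul_comm (R i i)] at h
    · exact mul_right_cancel₀ (hRii i) h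
    · intro k _ hk
      rcases lt_or_gt_of_ne hk with hk | hk
      · rw [hA hk, zero_mul]
      · rw [hR hk, mul_zero]
    · simp
  refine ⟨V, hV, A, ?_, hA, fun i j => ?_⟩
  · rw [hAdef]
    calc T = (V * star V) * T * (V * star V) := by rw [hVV, Matrix.one_mul, Matrix.mul_one]
      _ = _ := by simp only [Matrix.mul_assoc]
  · rw [hdiag, hdiag]
    induction j using WellFoundedLT.induction with
    | ind j ih =>
      intro hij hdij
      have h := congrFun (congrFun hAR i) j
      -- By triangularity and induction, only the terms `k = i` and `k = j` of `(A R)_ij` survive.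
      rw [Matrix.mul_diagonal, Matrix.mul_apply, Fintype.sum_eq_add i j hij.ne, hdiag, hdij,
        mul_comm (R i j), add_eq_left] at h
      · exact (mul_eq_zero.mp h).resolve_right (hRii j)
      · rintro k ⟨hki, hkj⟩
        rcases lt_or_gt_of_ne hki with hki | hki
        · rw [hA hki, zero_mul]
        rcases lt_or_gt_of_ne hkj with hkj | hkj
        · rw [ih k hkj hki (hdij.trans (hd i k j hki.le hkj.le hdij).symm), zero_mul]
        · rw [hR hkj, mul_zero]

/-! ### The squared Frobenius norm -/

/-- The squared Frobenius norm `∑ |a_ij|²` of a matrix. -/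
noncomputable def frobSq {r : ℕ} (A : Matrix (Fin r) (Fin r) ℂ) : ℝ :=
  ∑ i, ∑ j, ‖A i j‖ ^ 2

theorem frobSq_nonneg {r : ℕ} (A : Matrix (Fin r) (Fin r) ℂ) : 0 ≤ frobSq A :=
  Finset.sum_nonneg fun _ _ => Finset.sum_nonneg fun _ _ => sq_nonneg _

theorem frobSq_eq_re_trace {r : ℕ} (A : Matrix (Fin r) (Fin r) ℂ) :
    frobSq A = (A.conjTranspose * A).trace.re := by
  rw [frobSq, Finset.sum_comm, Matrix.trace, Complex.re_sum]
  refine Finset.sum_congr rfl fun j _ => ?_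
  rw [Matrix.diag_apply, Matrix.mul_apply, Complex.re_sum]
  refine Finset.sum_congr rfl fun i _ => ?_
  rw [Matrix.conjTranspose_apply, Complex.star_def, ← Complex.normSq_eq_conj_mul_self,
    Complex.ofReal_re, Complex.normSq_eq_norm_sq]

theorem norm_apply_sq_le_frobSq {r : ℕ} (A : Matrix (Fin r) (Fin r) ℂ) (i j : Fin r) :
    ‖A i j‖ ^ 2 ≤ frobSq A :=
  (Finset.single_le_sum (f := fun j => ‖A i j‖ ^ 2) (fun _ _ => sq_nonneg _)
    (Finset.mem_univ j)).trans
  (Finset.single_le_sum (f := fun i => ∑ j, ‖A i j‖ ^ 2)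
    (fun _ _ => Finset.sum_nonneg fun _ _ => sq_nonneg _) (Finset.mem_univ i))

theorem frobSq_smul {r : ℕ} (c : ℂ) (A : Matrix (Fin r) (Fin r) ℂ) :
    frobSq (c • A) = ‖c‖ ^ 2 * frobSq A := by
  simp only [frobSq, Matrix.smul_apply, smul_eq_mul, norm_mul, mul_pow, Finset.mul_sum]

theorem frobSq_add_le {r : ℕ} (A B : Matrix (Fin r) (Fin r) ℂ) :
    frobSq (A + B) ≤ 2 * frobSq A + 2 * frobSq B := by
  simp only [frobSq, Finset.mul_sum, ← Finset.sum_add_distrib]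
  refine Finset.sum_le_sum fun i _ => Finset.sum_le_sum fun j _ => ?_
  have h := norm_add_le (A i j) (B i j)
  rw [Matrix.add_apply]
  nlinarith [sq_nonneg (‖A i j‖ - ‖B i j‖), norm_nonneg (A i j + B i j)]

theorem frobSq_conjTranspose {r : ℕ} (A : Matrix (Fin r) (Fin r) ℂ) :
    frobSq A.conjTranspose = frobSq A := by
  rw [frobSq, Finset.sum_comm, frobSq]
  simp only [Matrix.conjTranspose_apply, norm_star]

theorem frobSq_neg {r : ℕ} (A : Matrix (Fin r) (Fin r) ℂ) : frobSq (-A) = frobSq A := by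
  simp only [frobSq, Matrix.neg_apply, norm_neg]

theorem frobSq_sub_le {r : ℕ} (A B : Matrix (Fin r) (Fin r) ℂ) :
    frobSq (A - B) ≤ 2 * frobSq A + 2 * frobSq B := by
  rw [sub_eq_add_neg, ← frobSq_neg B]
  exact frobSq_add_le A (-B)

theorem frobSq_mul_le {r : ℕ} (A B : Matrix (Fin r) (Fin r) ℂ) :
    frobSq (A * B) ≤ frobSq A * frobSq B := by
  rw [frobSq, frobSq, frobSq, Finset.sum_mul_sum]
  refine Finset.sum_le_sum fun i _ => ?_
  rw [← Finset.mul_sum, Finset.sum_comm (f := fun k j => ‖B k j‖ ^ 2), Finset.mul_sum]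
  refine Finset.sum_le_sum fun j _ => ?_
  rw [Matrix.mul_apply]
  have h1 : ‖∑ k, A i k * B k j‖ ≤ ∑ k, ‖A i k‖ * ‖B k j‖ :=
    (norm_sum_le _ _).trans_eq (by simp only [norm_mul])
  exact (pow_le_pow_left₀ (norm_nonneg _) h1 2).trans (Finset.sum_mul_sq_le_sq_mul_sq _ _ _)

theorem frobSq_unitary_conj {r : ℕ} {V : Matrix (Fin r) (Fin r) ℂ}
    (hV : V ∈ Matrix.unitaryGroup (Fin r) ℂ) (A : Matrix (Fin r) (Fin r) ℂ) :
    frobSq (V * A * star V) = frobSq A := by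
  have hVV : V.conjTranspose * V = 1 := Matrix.mem_unitaryGroup_iff'.mp hV
  rw [Matrix.star_eq_conjTranspose, frobSq_eq_re_trace, frobSq_eq_re_trace]
  congr 1
  simp only [Matrix.conjTranspose_mul, Matrix.conjTranspose_conjTranspose]
  rw [Matrix.trace_mul_comm]
  have : V * A * V.conjTranspose * (V * (A.conjTranspose * V.conjTranspose))
      = V * (A * (V.conjTranspose * V) * A.conjTranspose) * V.conjTranspose := by
    simp only [Matrix.mul_assoc]
  rw [this, hVV, Matrix.mul_one, Matrix.trace_mul_comm, ← Matrix.mul_assoc, hVV, Matrix.one_mul,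
    Matrix.trace_mul_comm]

/-! ### Energy estimates for one step of the Aluthge transform -/

theorem conjTranspose_polarFactor_mul_polarFactor_mul_abs {r : ℕ} (T : Matrix (Fin r) (Fin r) ℂ) :
    (polarFactor T).conjTranspose * polarFactor T * CFC.abs T = CFC.abs T := by
  have hU := (isPolarDecomposition_polarFactor T).partial_isometry
  have hT := polarFactor_mul_abs T
  have hP := conjTranspose_abs_matrix T
  have hPP := abs_mul_abs_matrix T
  generalize polarFactor T = U at *
  generalize CFC.abs T = P at *
  -- `F = U* U` is a projection with `P F P = T* T = P²`, so `(F P - P)* (F P - P) = 0`.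
  rw [← sub_eq_zero, ← Matrix.conjTranspose_mul_self_eq_zero]
  have h1 : P * U.conjTranspose * U * P = P * P := by
    rw [hPP, ← hT, Matrix.conjTranspose_mul, hP]
    simp only [Matrix.mul_assoc]
  have h2 : P * U.conjTranspose * (U * U.conjTranspose * U) * P = P * P := by rw [hU, h1]
  simp only [Matrix.conjTranspose_sub, Matrix.conjTranspose_mul, Matrix.conjTranspose_conjTranspose,
    hP, Matrix.sub_mul, Matrix.mul_sub]
  simp only [Matrix.mul_assoc] at h1 h2 ⊢
  rw [h1, h2]
  simp

/-- The absolute value `|T*| = U |T| U*` of the adjoint of `T = U |T|`. -/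
noncomputable def absAdjoint {r : ℕ} (T : Matrix (Fin r) (Fin r) ℂ) : Matrix (Fin r) (Fin r) ℂ :=
  polarFactor T * CFC.abs T * (polarFactor T).conjTranspose

theorem conjTranspose_absAdjoint {r : ℕ} (T : Matrix (Fin r) (Fin r) ℂ) :
    (absAdjoint T).conjTranspose = absAdjoint T := by
  simp only [absAdjoint, Matrix.conjTranspose_mul, Matrix.conjTranspose_conjTranspose,
    conjTranspose_abs_matrix, Matrix.mul_assoc]

theorem absAdjoint_mul_absAdjoint {r : ℕ} (T : Matrix (Fin r) (Fin r) ℂ) :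
    absAdjoint T * absAdjoint T = T * T.conjTranspose := by
  have h := conjTranspose_polarFactor_mul_polarFactor_mul_abs T
  calc absAdjoint T * absAdjoint T = polarFactor T * CFC.abs T *
        ((polarFactor T).conjTranspose * polarFactor T * CFC.abs T) *
        (polarFactor T).conjTranspose := by simp only [absAdjoint, Matrix.mul_assoc]
    _ = (polarFactor T * CFC.abs T) * (polarFactor T * CFC.abs T).conjTranspose := by
        rw [h, Matrix.conjTranspose_mul, conjTranspose_abs_matrix, Matrix.mul_assoc _ (CFC.abs T)]
    _ = _ := by rw [polarFactor_mul_abs]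

theorem absAdjoint_mul_polarFactor {r : ℕ} (T : Matrix (Fin r) (Fin r) ℂ) :
    absAdjoint T * polarFactor T = polarFactor T * CFC.abs T := by
  have h := congrArg Matrix.conjTranspose (conjTranspose_polarFactor_mul_polarFactor_mul_abs T)
  simp only [Matrix.conjTranspose_mul, Matrix.conjTranspose_conjTranspose,
    conjTranspose_abs_matrix] at h
  rw [absAdjoint, Matrix.mul_assoc, Matrix.mul_assoc, h]

theorem frobSq_abs {r : ℕ} (T : Matrix (Fin r) (Fin r) ℂ) : frobSq (CFC.abs T) = frobSq T := by
  rw [frobSq_eq_re_trace, frobSq_eq_re_trace, conjTranspose_abs_matrix, abs_mul_abs_matrix]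

theorem frobSq_absAdjoint {r : ℕ} (T : Matrix (Fin r) (Fin r) ℂ) :
    frobSq (absAdjoint T) = frobSq T := by
  rw [frobSq_eq_re_trace, frobSq_eq_re_trace, conjTranspose_absAdjoint, absAdjoint_mul_absAdjoint,
    Matrix.trace_mul_comm]

theorem frobSq_aluthge {r : ℕ} (T : Matrix (Fin r) (Fin r) ℂ) :
    frobSq (aluthge T) = (absAdjoint T * CFC.abs T).trace.re := by
  rw [frobSq_eq_re_trace]
  congr 1
  have e : (aluthge T).conjTranspose * aluthge T
      = CFC.sqrt (CFC.abs T) * (polarFactor T).conjTranspose *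
        (CFC.sqrt (CFC.abs T) * CFC.sqrt (CFC.abs T)) * (polarFactor T * CFC.sqrt (CFC.abs T)) := by
    simp only [aluthge, Matrix.conjTranspose_mul, conjTranspose_sqrt_abs, Matrix.mul_assoc]
  rw [e, sqrt_abs_mul_sqrt_abs, Matrix.trace_mul_comm, absAdjoint]
  have e2 : polarFactor T * CFC.sqrt (CFC.abs T) *
        (CFC.sqrt (CFC.abs T) * (polarFactor T).conjTranspose * CFC.abs T)
      = polarFactor T * (CFC.sqrt (CFC.abs T) * CFC.sqrt (CFC.abs T)) *
        (polarFactor T).conjTranspose * CFC.abs T := by simp only [Matrix.mul_assoc]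
  rw [e2, sqrt_abs_mul_sqrt_abs]

/-- The energy identity: the squared Frobenius norm drops by half the squared distance of `|T|`
and `|T*|`. -/
theorem frobSq_abs_sub_absAdjoint {r : ℕ} (T : Matrix (Fin r) (Fin r) ℂ) :
    frobSq (CFC.abs T - absAdjoint T) = 2 * (frobSq T - frobSq (aluthge T)) := by
  have h1 := frobSq_abs T
  have h2 := frobSq_absAdjoint T
  have h3 := frobSq_aluthge T
  rw [frobSq_eq_re_trace] at h1 h2
  rw [conjTranspose_abs_matrix] at h1
  rw [conjTranspose_absAdjoint] at h2
  rw [frobSq_eq_re_trace, Matrix.conjTranspose_sub, conjTranspose_abs_matrix,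
    conjTranspose_absAdjoint, Matrix.sub_mul, Matrix.mul_sub, Matrix.mul_sub, Matrix.trace_sub,
    Matrix.trace_sub, Matrix.trace_sub, Matrix.trace_mul_comm (CFC.abs T) (absAdjoint T)]
  simp only [Complex.sub_re]
  linarith

theorem frobSq_aluthge_le {r : ℕ} (T : Matrix (Fin r) (Fin r) ℂ) :
    frobSq (aluthge T) ≤ frobSq T := by
  linarith [frobSq_abs_sub_absAdjoint T, frobSq_nonneg (CFC.abs T - absAdjoint T)]

/-- The self-commutator `T* T - T T*`. -/
noncomputable def selfCommutator {r : ℕ} (T : Matrix (Fin r) (Fin r) ℂ) : Matrix (Fin r) (Fin r) ℂ :=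
  T.conjTranspose * T - T * T.conjTranspose

theorem frobSq_selfCommutator_le {r : ℕ} (T : Matrix (Fin r) (Fin r) ℂ) :
    frobSq (selfCommutator T) ≤ 8 * frobSq T * (frobSq T - frobSq (aluthge T)) := by
  have e : (2 : ℂ) • selfCommutator T
      = (CFC.abs T - absAdjoint T) * (CFC.abs T + absAdjoint T)
        + (CFC.abs T + absAdjoint T) * (CFC.abs T - absAdjoint T) := by
    rw [selfCommutator, ← abs_mul_abs_matrix, ← absAdjoint_mul_absAdjoint, two_smul]
    noncomm_ring
  have h1 := frobSq_smul 2 (selfCommutator T)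
  rw [e, Complex.norm_ofNat] at h1
  have h2 := frobSq_add_le ((CFC.abs T - absAdjoint T) * (CFC.abs T + absAdjoint T))
    ((CFC.abs T + absAdjoint T) * (CFC.abs T - absAdjoint T))
  have h3 := frobSq_mul_le (CFC.abs T - absAdjoint T) (CFC.abs T + absAdjoint T)
  have h4 := frobSq_mul_le (CFC.abs T + absAdjoint T) (CFC.abs T - absAdjoint T)
  have h5 := frobSq_add_le (CFC.abs T) (absAdjoint T)
  rw [frobSq_abs, frobSq_absAdjoint] at h5
  have h6 := mul_le_mul_of_nonneg_left h5 (frobSq_nonneg (CFC.abs T - absAdjoint T))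
  rw [frobSq_abs_sub_absAdjoint] at h3 h4 h6
  linarith

/-- In an anticommutator `R X + X R` with `R ≥ 0` the two terms form an acute angle, since
`tr (X* R X R) ≥ 0`. -/
theorem frobSq_mul_le_frobSq_anticommutator {r : ℕ} {R : Matrix (Fin r) (Fin r) ℂ} (hR : 0 ≤ R)
    (X : Matrix (Fin r) (Fin r) ℂ) : frobSq (X * R) ≤ frobSq (R * X + X * R) := by
  have hRH : R.conjTranspose = R := hR.isSelfAdjoint
  have hSH : (CFC.sqrt R).conjTranspose = CFC.sqrt R := (CFC.sqrt_nonneg R).isSelfAdjoint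
  have hSS : CFC.sqrt R * CFC.sqrt R = R := CFC.sqrt_mul_sqrt_self _ hR
  have h0 := frobSq_nonneg (CFC.sqrt R * X * CFC.sqrt R)
  have e0 : (CFC.sqrt R * X * CFC.sqrt R).conjTranspose * (CFC.sqrt R * X * CFC.sqrt R)
      = CFC.sqrt R * (X.conjTranspose * (CFC.sqrt R * CFC.sqrt R) * X * CFC.sqrt R) := by
    simp only [Matrix.conjTranspose_mul, hSH, Matrix.mul_assoc]
  have e1 : X.conjTranspose * R * X * CFC.sqrt R * CFC.sqrt R = X.conjTranspose * R * (X * R) := by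
    rw [Matrix.mul_assoc, hSS, Matrix.mul_assoc _ X]
  rw [frobSq_eq_re_trace, e0, hSS, Matrix.trace_mul_comm, e1] at h0
  have h1 : frobSq (R * X + X * R) = frobSq (R * X) + frobSq (X * R)
      + 2 * (X.conjTranspose * R * (X * R)).trace.re := by
    have e2 : (X * R).conjTranspose * (R * X) = (X.conjTranspose * R * (X * R)).conjTranspose := by
      simp only [Matrix.conjTranspose_mul, hRH, Matrix.conjTranspose_conjTranspose,
        Matrix.mul_assoc]
    rw [frobSq_eq_re_trace, Matrix.conjTranspose_add, Matrix.add_mul, Matrix.mul_add,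
      Matrix.mul_add, e2, frobSq_eq_re_trace, frobSq_eq_re_trace, Matrix.conjTranspose_mul R X, hRH]
    simp only [Matrix.trace_add, Complex.add_re, Matrix.trace_conjTranspose, Complex.star_def,
      Complex.conj_re]
    ring
  linarith [frobSq_nonneg (R * X)]

theorem frobSq_mul_polarFactor_le {r : ℕ} (T W : Matrix (Fin r) (Fin r) ℂ) :
    frobSq (W * polarFactor T) ≤ frobSq W := by
  have hU := (isPolarDecomposition_polarFactor T).partial_isometry
  generalize polarFactor T = U at *
  -- `1 - U U*` is an orthogonal projection, and `‖W‖² = ‖W U‖² + ‖W (1 - U U*)‖²`.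
  have h0 := frobSq_nonneg (W * (1 - U * U.conjTranspose))
  have hE : (1 - U * U.conjTranspose) * (1 - U * U.conjTranspose) = 1 - U * U.conjTranspose := by
    rw [Matrix.mul_sub, Matrix.mul_one, Matrix.sub_mul, Matrix.one_mul, ← Matrix.mul_assoc, hU,
      sub_self, sub_zero]
  have hEH : (1 - U * U.conjTranspose).conjTranspose = 1 - U * U.conjTranspose := by
    simp
  have e1 : ((W * (1 - U * U.conjTranspose)).conjTranspose
      * (W * (1 - U * U.conjTranspose))).trace.re
      = (W.conjTranspose * W).trace.re - (W.conjTranspose * W * (U * U.conjTranspose)).trace.re := by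
    rw [Matrix.conjTranspose_mul, hEH, Matrix.mul_assoc, Matrix.trace_mul_comm, ← Matrix.mul_assoc,
      Matrix.mul_assoc, hE, Matrix.mul_sub, Matrix.mul_one, Matrix.trace_sub, Complex.sub_re]
  have e2 : frobSq (W * U) = (W.conjTranspose * W * (U * U.conjTranspose)).trace.re := by
    rw [frobSq_eq_re_trace, Matrix.conjTranspose_mul, Matrix.mul_assoc, Matrix.trace_mul_comm]
    simp only [Matrix.mul_assoc]
  rw [frobSq_eq_re_trace, e1, ← e2, ← frobSq_eq_re_trace] at h0
  linarith

/-- With `R = |T|^{1/2}` and `X = R U - U R`, the step is `Δ(T) - T = X R`, while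
`R X + X R = |T| U - U |T| = (|T| - |T*|) U`. -/
theorem frobSq_aluthge_sub_le {r : ℕ} (T : Matrix (Fin r) (Fin r) ℂ) :
    frobSq (aluthge T - T) ≤ 2 * (frobSq T - frobSq (aluthge T)) := by
  have hRR := sqrt_abs_mul_sqrt_abs T
  have e1 : aluthge T - T = (CFC.sqrt (CFC.abs T) * polarFactor T
      - polarFactor T * CFC.sqrt (CFC.abs T)) * CFC.sqrt (CFC.abs T) := by
    rw [Matrix.sub_mul, polarFactor_mul_sqrt_mul_sqrt, aluthge]
  have h1 := frobSq_mul_le_frobSq_anticommutator (CFC.sqrt_nonneg (CFC.abs T))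
    (CFC.sqrt (CFC.abs T) * polarFactor T - polarFactor T * CFC.sqrt (CFC.abs T))
  have e2 : CFC.sqrt (CFC.abs T) * (CFC.sqrt (CFC.abs T) * polarFactor T
      - polarFactor T * CFC.sqrt (CFC.abs T)) + (CFC.sqrt (CFC.abs T) * polarFactor T
      - polarFactor T * CFC.sqrt (CFC.abs T)) * CFC.sqrt (CFC.abs T)
      = (CFC.abs T - absAdjoint T) * polarFactor T := by
    rw [Matrix.sub_mul (CFC.abs T), absAdjoint_mul_polarFactor]
    generalize CFC.sqrt (CFC.abs T) = R at hRR ⊢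
    rw [← hRR]
    noncomm_ring
  rw [e2, ← e1] at h1
  rw [← frobSq_abs_sub_absAdjoint]
  exact h1.trans (frobSq_mul_polarFactor_le T _)

/-! ### The departure from normality -/

/-- Henrici's departure from normality (squared): `∑ |t_ij|² - ∑ |λ|²`, with the eigenvalues `λ`
counted with algebraic multiplicity. -/
noncomputable def normalDefect {r : ℕ} (T : Matrix (Fin r) (Fin r) ℂ) : ℝ :=
  frobSq T - (T.charpoly.roots.map fun z => ‖z‖ ^ 2).sum

/-- The off-diagonal part of a matrix. -/
noncomputable def offDiag {r : ℕ} (A : Matrix (Fin r) (Fin r) ℂ) : Matrix (Fin r) (Fin r) ℂ :=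
  A - Matrix.diagonal A.diag

theorem offDiag_apply_self {r : ℕ} (A : Matrix (Fin r) (Fin r) ℂ) (i : Fin r) :
    offDiag A i i = 0 := by
  simp [offDiag]

theorem offDiag_apply_of_ne {r : ℕ} (A : Matrix (Fin r) (Fin r) ℂ) {i j : Fin r} (h : i ≠ j) :
    offDiag A i j = A i j := by
  simp [offDiag, Matrix.diagonal_apply_ne _ h]

theorem frobSq_eq_sum_diag_add_frobSq_offDiag {r : ℕ} (A : Matrix (Fin r) (Fin r) ℂ) :
    frobSq A = ∑ i, ‖A i i‖ ^ 2 + frobSq (offDiag A) := by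
  rw [frobSq, frobSq, ← Finset.sum_add_distrib]
  refine Finset.sum_congr rfl fun i _ => ?_
  rw [← Finset.add_sum_erase _ _ (Finset.mem_univ i),
    ← Finset.add_sum_erase (a := i) _ (fun j => ‖offDiag A i j‖ ^ 2) (Finset.mem_univ i),
    offDiag_apply_self, norm_zero, zero_pow two_ne_zero, zero_add]
  congr 1
  refine Finset.sum_congr rfl fun j hj => ?_
  rw [offDiag_apply_of_ne A (Finset.ne_of_mem_erase hj).symm]

theorem roots_charpoly_unitary_conj {r : ℕ} {V A : Matrix (Fin r) (Fin r) ℂ}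
    (hV : V ∈ Matrix.unitaryGroup (Fin r) ℂ) (hA : A.IsUpperTriangular) :
    (V * A * star V).charpoly.roots = Finset.univ.val.map fun i => A i i := by
  have hVV : star V * V = 1 := Matrix.mem_unitaryGroup_iff'.mp hV
  rw [Matrix.charpoly_mul_comm, ← Matrix.mul_assoc, hVV, Matrix.one_mul,
    Matrix.charpoly_of_isUpperTriangular A hA]
  have h := Polynomial.roots_multiset_prod_X_sub_C (Finset.univ.val.map fun i => A i i)
  rw [Multiset.map_map] at h
  exact h

theorem normalDefect_unitary_conj {r : ℕ} {V A : Matrix (Fin r) (Fin r) ℂ}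
    (hV : V ∈ Matrix.unitaryGroup (Fin r) ℂ) (hA : A.IsUpperTriangular) :
    normalDefect (V * A * star V) = frobSq (offDiag A) := by
  rw [normalDefect, roots_charpoly_unitary_conj hV hA, frobSq_unitary_conj hV,
    frobSq_eq_sum_diag_add_frobSq_offDiag, Multiset.map_map]
  exact add_sub_cancel_left _ _

theorem frobSq_selfCommutator_unitary_conj {r : ℕ} {V : Matrix (Fin r) (Fin r) ℂ}
    (hV : V ∈ Matrix.unitaryGroup (Fin r) ℂ) (A : Matrix (Fin r) (Fin r) ℂ) :
    frobSq (selfCommutator (V * A * star V)) = frobSq (selfCommutator A) := by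
  have hVV : V.conjTranspose * V = 1 := Matrix.mem_unitaryGroup_iff'.mp hV
  rw [← frobSq_unitary_conj hV (selfCommutator A)]
  congr 1
  simp only [selfCommutator, Matrix.star_eq_conjTranspose, Matrix.conjTranspose_mul,
    Matrix.conjTranspose_conjTranspose, Matrix.mul_sub, Matrix.sub_mul]
  congr 1
  · calc _ = V * A.conjTranspose * (V.conjTranspose * V) * A * V.conjTranspose := by
          simp only [Matrix.mul_assoc]
      _ = _ := by rw [hVV, Matrix.mul_one]; simp only [Matrix.mul_assoc]
  · calc _ = V * A * (V.conjTranspose * V) * A.conjTranspose * V.conjTranspose := by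
          simp only [Matrix.mul_assoc]
      _ = _ := by rw [hVV, Matrix.mul_one]; simp only [Matrix.mul_assoc]

/-- Weighting the diagonal of the self-commutator by the index `k` turns it into a sum that, for a
triangular matrix, has only nonnegative terms. -/
theorem sum_mul_re_selfCommutator_apply_self {r : ℕ} (A : Matrix (Fin r) (Fin r) ℂ) :
    ∑ k : Fin r, (k : ℝ) * (selfCommutator A k k).re
      = ∑ i : Fin r, ∑ j : Fin r, ((j : ℝ) - (i : ℝ)) * ‖A i j‖ ^ 2 := by
  have h : ∀ k, (selfCommutator A k k).re = ∑ i, ‖A i k‖ ^ 2 - ∑ j, ‖A k j‖ ^ 2 := by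
    intro k
    rw [selfCommutator, Matrix.sub_apply, Complex.sub_re, Matrix.mul_apply, Matrix.mul_apply,
      Complex.re_sum, Complex.re_sum]
    congr 1 <;> refine Finset.sum_congr rfl fun i _ => ?_
    · rw [Matrix.conjTranspose_apply, Complex.star_def, ← Complex.normSq_eq_conj_mul_self,
        Complex.ofReal_re, Complex.normSq_eq_norm_sq]
    · rw [Matrix.conjTranspose_apply, Complex.star_def, Complex.mul_conj, Complex.ofReal_re,
        Complex.normSq_eq_norm_sq]
  simp only [h, mul_sub, sub_mul, Finset.sum_sub_distrib, Finset.mul_sum]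
  rw [Finset.sum_comm]

/-- In `∑ k c_kk`, with `c_kk` the diagonal entries of the self-commutator, each entry `|a_ij|²` with
`i < j` has the weight `j - i ≥ 1`; the bound then follows from the Cauchy-Schwarz inequality. -/
theorem frobSq_offDiag_sq_le {r : ℕ} {A : Matrix (Fin r) (Fin r) ℂ} (hA : A.IsUpperTriangular) :
    frobSq (offDiag A) ^ 2 ≤ (∑ k : Fin r, (k : ℝ) ^ 2) * frobSq (selfCommutator A) := by
  have h1 : frobSq (offDiag A) ≤ ∑ k : Fin r, (k : ℝ) * (selfCommutator A k k).re := by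
    rw [sum_mul_re_selfCommutator_apply_self, frobSq]
    refine Finset.sum_le_sum fun i _ => Finset.sum_le_sum fun j _ => ?_
    rcases lt_trichotomy i j with h | rfl | h
    · rw [offDiag_apply_of_ne A h.ne]
      have : (i : ℝ) + 1 ≤ j := by exact_mod_cast Nat.succ_le_of_lt h
      nlinarith [sq_nonneg ‖A i j‖]
    · simp [offDiag_apply_self]
    · rw [offDiag_apply_of_ne A h.ne', hA h]
      simp
  refine (pow_le_pow_left₀ (frobSq_nonneg _) h1 2).trans
    ((Finset.sum_mul_sq_le_sq_mul_sq _ _ _).trans ?_)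
  refine mul_le_mul_of_nonneg_left ?_ (Finset.sum_nonneg fun _ _ => sq_nonneg _)
  refine Finset.sum_le_sum fun k _ => le_trans ?_ (Finset.single_le_sum
    (f := fun j => ‖selfCommutator A k j‖ ^ 2) (fun _ _ => sq_nonneg _) (Finset.mem_univ k))
  exact sq_le_sq.mpr ((Complex.abs_re_le_norm _).trans (le_abs_self _))

/-- Write `A = D + N` with `D` diagonal and `N` strictly upper triangular. Above the diagonal,
`A* A - A A*` has the entries `(conj d_i - conj d_j) n_ij` up to the quadratic term
`N* N - N N*`. -/
theorem sq_mul_frobSq_offDiag_le {r : ℕ} {A : Matrix (Fin r) (Fin r) ℂ} (hA : A.IsUpperTriangular)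
    {δ : ℝ} (hδ : 0 ≤ δ) (hsep : ∀ i j, i < j → A i j ≠ 0 → δ ≤ ‖A i i - A j j‖) :
    δ ^ 2 * frobSq (offDiag A)
      ≤ 2 * frobSq (selfCommutator A) + 8 * frobSq (offDiag A) ^ 2 := by
  have e : selfCommutator A - selfCommutator (offDiag A)
      = (Matrix.diagonal (star A.diag) * offDiag A - offDiag A * Matrix.diagonal (star A.diag))
        + ((offDiag A).conjTranspose * Matrix.diagonal A.diag
          - Matrix.diagonal A.diag * (offDiag A).conjTranspose) := by
    have hcomm : Matrix.diagonal (star A.diag) * Matrix.diagonal A.diag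
        = Matrix.diagonal A.diag * Matrix.diagonal (star A.diag) :=
      Matrix.commute_diagonal _ _
    have hAD : A = Matrix.diagonal A.diag + offDiag A := by simp [offDiag]
    have hAD' : A.conjTranspose = Matrix.diagonal (star A.diag) + (offDiag A).conjTranspose := by
      conv_lhs => rw [hAD]
      rw [Matrix.conjTranspose_add, Matrix.diagonal_conjTranspose]
    rw [selfCommutator, selfCommutator, hAD']
    generalize offDiag A = N at *
    generalize Matrix.diagonal (star A.diag) = D' at *
    generalize Matrix.diagonal A.diag = D at *
    rw [hAD]
    simp only [Matrix.add_mul, Matrix.mul_add, hcomm]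
    abel
  have h1 : δ ^ 2 * frobSq (offDiag A)
      ≤ frobSq (selfCommutator A - selfCommutator (offDiag A)) := by
    rw [e, frobSq, frobSq, Finset.mul_sum]
    simp only [Finset.mul_sum]
    refine Finset.sum_le_sum fun i _ => Finset.sum_le_sum fun j _ => ?_
    by_cases h0 : offDiag A i j = 0
    · rw [h0]
      simp
    have hij : i < j := by
      rcases lt_trichotomy i j with h | rfl | h
      · exact h
      · exact absurd (offDiag_apply_self A i) h0
      · exact absurd ((offDiag_apply_of_ne A h.ne').trans (hA h)) h0
    have hji : offDiag A j i = 0 := (offDiag_apply_of_ne A hij.ne').trans (hA hij)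
    have hd := hsep i j hij (offDiag_apply_of_ne A hij.ne ▸ h0)
    have e2 : ((Matrix.diagonal (star A.diag) * offDiag A
          - offDiag A * Matrix.diagonal (star A.diag))
        + ((offDiag A).conjTranspose * Matrix.diagonal A.diag
          - Matrix.diagonal A.diag * (offDiag A).conjTranspose)) i j
        = star (A i i - A j j) * offDiag A i j := by
      simp only [Matrix.add_apply, Matrix.sub_apply, Matrix.diagonal_mul, Matrix.mul_diagonal,
        Matrix.conjTranspose_apply, hji, star_zero, Pi.star_apply, Matrix.diag_apply, star_sub]
      ring
    rw [e2, norm_mul, norm_star, mul_pow]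
    exact mul_le_mul_of_nonneg_right (pow_le_pow_left₀ hδ hd 2) (sq_nonneg _)
  have h2 := frobSq_sub_le (selfCommutator A) (selfCommutator (offDiag A))
  have h3 : frobSq (selfCommutator (offDiag A)) ≤ 4 * frobSq (offDiag A) ^ 2 := by
    have h4 := frobSq_sub_le ((offDiag A).conjTranspose * offDiag A)
      (offDiag A * (offDiag A).conjTranspose)
    have h5 := frobSq_mul_le (offDiag A).conjTranspose (offDiag A)
    have h6 := frobSq_mul_le (offDiag A) (offDiag A).conjTranspose
    rw [frobSq_conjTranspose] at h5 h6
    rw [selfCommutator]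
    linarith
  linarith

theorem IsDiagonalizableMatrix.normalDefect_nonneg {r : ℕ} {T : Matrix (Fin r) (Fin r) ℂ}
    (hT : IsDiagonalizableMatrix T) : 0 ≤ normalDefect T := by
  obtain ⟨V, hV, A, rfl, hA, -⟩ := hT.exists_schur
  rw [normalDefect_unitary_conj hV hA]
  exact frobSq_nonneg _

theorem IsDiagonalizableMatrix.normalDefect_sq_le {r : ℕ} {T : Matrix (Fin r) (Fin r) ℂ}
    (hT : IsDiagonalizableMatrix T) :
    normalDefect T ^ 2 ≤ (∑ k : Fin r, (k : ℝ) ^ 2) * frobSq (selfCommutator T) := by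
  obtain ⟨V, hV, A, rfl, hA, -⟩ := hT.exists_schur
  rw [normalDefect_unitary_conj hV hA, frobSq_selfCommutator_unitary_conj hV]
  exact frobSq_offDiag_sq_le hA

/-- Near the normal matrices, the self-commutator of a diagonalizable matrix controls the square
root of the departure from normality, with a constant given by the gap between distinct
eigenvalues. -/
theorem IsDiagonalizableMatrix.sq_mul_normalDefect_le {r : ℕ} {T : Matrix (Fin r) (Fin r) ℂ}
    (hT : IsDiagonalizableMatrix T) {δ : ℝ} (hδ : 0 ≤ δ)
    (hsep : ∀ x ∈ T.charpoly.roots, ∀ y ∈ T.charpoly.roots, x ≠ y → δ ≤ ‖x - y‖) :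
    δ ^ 2 * normalDefect T ≤ 2 * frobSq (selfCommutator T) + 8 * normalDefect T ^ 2 := by
  obtain ⟨V, hV, A, rfl, hA, hA0⟩ := hT.exists_schur
  rw [normalDefect_unitary_conj hV hA, frobSq_selfCommutator_unitary_conj hV]
  rw [roots_charpoly_unitary_conj hV hA] at hsep
  refine sq_mul_frobSq_offDiag_le hA hδ fun i j hij hne => hsep _ ?_ _ ?_ fun h => ?_
  · exact Multiset.mem_map_of_mem _ (Finset.mem_univ i)
  · exact Multiset.mem_map_of_mem _ (Finset.mem_univ j)
  · exact hne (hA0 i j hij h)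

theorem frobSq_sub_frobSq_aluthge {r : ℕ} (T : Matrix (Fin r) (Fin r) ℂ) :
    frobSq T - frobSq (aluthge T) = normalDefect T - normalDefect (aluthge T) := by
  rw [normalDefect, normalDefect, charpoly_aluthge]
  ring

theorem exists_pos_le_norm_sub (s : Multiset ℂ) :
    ∃ δ : ℝ, 0 < δ ∧ ∀ x ∈ s, ∀ y ∈ s, x ≠ y → δ ≤ ‖x - y‖ := by
  rcases s.toFinset.offDiag.eq_empty_or_nonempty with h | h
  · refine ⟨1, one_pos, fun x hx y hy hxy => ?_⟩
    have : (x, y) ∈ s.toFinset.offDiag := by simp [hx, hy, hxy]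
    simp [h] at this
  · obtain ⟨p, hp, hmin⟩ := s.toFinset.offDiag.exists_min_image (fun p => ‖p.1 - p.2‖) h
    refine ⟨‖p.1 - p.2‖, ?_, fun x hx y hy hxy => ?_⟩
    · exact norm_pos_iff.mpr (sub_ne_zero.mpr (Finset.mem_offDiag.mp hp).2.2)
    · exact hmin (x, y) (by simp [hx, hy, hxy])

/-! ### Convergence -/

/-- A decreasing sequence of nonnegative reals decays geometrically if `f n ^ 2` is controlled by
the decrement (which forces `f n → 0`) and `f n` is controlled by the decrement up to a quadratic
error. -/
theorem exists_geometric_bound_of_decrement {f : ℕ → ℝ} {a b c d : ℝ} (hf0 : ∀ n, 0 ≤ f n)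
    (hf : Antitone f) (h2 : ∀ n, f n ^ 2 ≤ a * (f n - f (n + 1))) (hb : 0 < b) (hc : 0 ≤ c)
    (h1 : ∀ n, b * f n ≤ c * (f n - f (n + 1)) + d * f n ^ 2) :
    ∃ N : ℕ, ∃ γ : ℝ, 0 ≤ γ ∧ γ < 1 ∧ ∀ n, f (n + N) ≤ f N * γ ^ n := by
  obtain ⟨l, hl⟩ : ∃ l, Tendsto f atTop (𝓝 l) :=
    ⟨_, tendsto_atTop_ciInf hf ⟨0, by rintro _ ⟨n, rfl⟩; exact hf0 n⟩⟩
  have hl1 : Tendsto (fun n => f (n + 1)) atTop (𝓝 l) := (tendsto_add_atTop_iff_nat 1).mpr hl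
  have hll : l ^ 2 ≤ a * (l - l) :=
    le_of_tendsto_of_tendsto' (hl.pow 2) ((hl.sub hl1).const_mul a) h2
  have hl0 : l = 0 := by
    rw [sub_self, mul_zero] at hll
    exact pow_eq_zero_iff two_ne_zero |>.mp (le_antisymm hll (sq_nonneg l))
  subst hl0
  have hsmall : ∀ᶠ n in atTop, d * f n < b / 2 := by
    have := hl.const_mul d
    rw [mul_zero] at this
    exact this.eventually_lt_const (half_pos hb)
  obtain ⟨N, hN⟩ := eventually_atTop.mp hsmall
  have hcb : 0 < c + b := by linarith
  have hγ : 1 - b / (2 * (c + b)) = (2 * c + b) / (2 * (c + b)) := by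
    field_simp
    ring
  refine ⟨N, 1 - b / (2 * (c + b)), ?_, ?_, fun n => ?_⟩
  · rw [hγ]
    positivity
  · have : 0 < b / (2 * (c + b)) := by positivity
    linarith
  · induction n with
    | zero => simp
    | succ n ih =>
      have hstep : f (n + 1 + N) ≤ f (n + N) * (1 - b / (2 * (c + b))) := by
        have h3 := h1 (n + N)
        have h4 := hN (n + N) (Nat.le_add_left _ _)
        have h5 := mul_le_mul_of_nonneg_right h4.le (hf0 (n + N))
        have h6 : f (n + N + 1) ≤ f (n + N) := hf (Nat.le_succ _)
        have h7 := mul_le_mul_of_nonneg_left h6 hb.le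
        rw [show n + 1 + N = n + N + 1 by ring, hγ, mul_div_assoc', le_div_iff₀ (by positivity)]
        nlinarith
      rw [pow_succ, ← mul_assoc]
      refine hstep.trans (mul_le_mul_of_nonneg_right ih ?_)
      rw [hγ]
      positivity

theorem iterate_aluthge_succ {r : ℕ} (T : Matrix (Fin r) (Fin r) ℂ) (n : ℕ) :
    aluthge^[n + 1] T = aluthge (aluthge^[n] T) :=
  Function.iterate_succ_apply' _ _ _

theorem charpoly_iterate_aluthge {r : ℕ} (T : Matrix (Fin r) (Fin r) ℂ) (n : ℕ) :
    (aluthge^[n] T).charpoly = T.charpoly := by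
  induction n with
  | zero => rfl
  | succ n ih => rw [iterate_aluthge_succ, charpoly_aluthge, ih]

theorem isDiagonalizableMatrix_iterate_aluthge {r : ℕ} {T : Matrix (Fin r) (Fin r) ℂ}
    (hT : IsDiagonalizableMatrix T) (n : ℕ) : IsDiagonalizableMatrix (aluthge^[n] T) := by
  induction n with
  | zero => exact hT
  | succ n ih =>
    rw [iterate_aluthge_succ]
    exact aluthge_isDiagonalizableMatrix ih

theorem frobSq_iterate_aluthge_le {r : ℕ} (T : Matrix (Fin r) (Fin r) ℂ) (n : ℕ) :
    frobSq (aluthge^[n] T) ≤ frobSq T := by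
  induction n with
  | zero => rfl
  | succ n ih =>
    rw [iterate_aluthge_succ]
    exact (frobSq_aluthge_le _).trans ih

/-- Along the iteration the self-commutator is controlled by the decrement of the departure from
normality, and in turn controls the departure itself, which therefore decays geometrically. -/
theorem exists_geometric_bound_normalDefect {r : ℕ} {T : Matrix (Fin r) (Fin r) ℂ}
    (hT : IsDiagonalizableMatrix T) :
    ∃ N : ℕ, ∃ γ : ℝ, 0 ≤ γ ∧ γ < 1 ∧
      ∀ n, normalDefect (aluthge^[n + N] T) ≤ normalDefect (aluthge^[N] T) * γ ^ n := by
  have hdec : ∀ n, frobSq (aluthge^[n] T) - frobSq (aluthge^[n + 1] T)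
      = normalDefect (aluthge^[n] T) - normalDefect (aluthge^[n + 1] T) := fun n => by
    rw [iterate_aluthge_succ, frobSq_sub_frobSq_aluthge]
  have hcomm : ∀ n, frobSq (selfCommutator (aluthge^[n] T))
      ≤ 8 * frobSq T * (normalDefect (aluthge^[n] T) - normalDefect (aluthge^[n + 1] T)) := by
    intro n
    have h1 := frobSq_selfCommutator_le (aluthge^[n] T)
    have h2 := frobSq_aluthge_le (aluthge^[n] T)
    rw [← iterate_aluthge_succ] at h1 h2
    rw [← hdec n]
    refine h1.trans (mul_le_mul_of_nonneg_right ?_ (sub_nonneg.mpr h2))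
    linarith [frobSq_iterate_aluthge_le T n]
  obtain ⟨δ, hδ, hsep⟩ := exists_pos_le_norm_sub T.charpoly.roots
  refine exists_geometric_bound_of_decrement (f := fun n => normalDefect (aluthge^[n] T))
    (a := (∑ k : Fin r, (k : ℝ) ^ 2) * (8 * frobSq T)) (b := δ ^ 2) (c := 2 * (8 * frobSq T))
    (d := 8)
    (fun n => (isDiagonalizableMatrix_iterate_aluthge hT n).normalDefect_nonneg)
    (antitone_nat_of_succ_le fun n => ?_) (fun n => ?_) (by positivity)
    (by have := frobSq_nonneg T; positivity) (fun n => ?_)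
  · have h := frobSq_aluthge_le (aluthge^[n] T)
    rw [← iterate_aluthge_succ] at h
    linarith [hdec n]
  · refine (isDiagonalizableMatrix_iterate_aluthge hT n).normalDefect_sq_le.trans ?_
    rw [mul_assoc]
    exact mul_le_mul_of_nonneg_left (hcomm n) (Finset.sum_nonneg fun _ _ => sq_nonneg _)
  · have h := (isDiagonalizableMatrix_iterate_aluthge hT n).sq_mul_normalDefect_le hδ.le
      (by rwa [charpoly_iterate_aluthge])
    have h' := hcomm n
    linarith

theorem mainTheorem1 (r : ℕ) (T : Matrix (Fin r) (Fin r) ℂ) (hT : IsDiagonalizableMatrix T) :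
    ∃ L : Matrix (Fin r) (Fin r) ℂ,
      Tendsto (fun n : ℕ => aluthge^[n] T) atTop (𝓝 L) := by
  obtain ⟨N, γ, hγ0, hγ1, hγ⟩ := exists_geometric_bound_normalDefect hT
  have hcauchy : ∀ i j, CauchySeq fun n => (aluthge^[n + N] T) i j := by
    intro i j
    refine cauchySeq_of_le_geometric (√γ) (√(2 * normalDefect (aluthge^[N] T)))
      ((Real.sqrt_lt' one_pos).mpr (by rwa [one_pow])) fun n => ?_
    rw [dist_comm, dist_eq_norm, ← pow_le_pow_iff_left₀ (norm_nonneg _)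
      (by positivity) two_ne_zero, mul_pow, ← pow_mul, mul_comm n 2, pow_mul, Real.sq_sqrt hγ0,
      Real.sq_sqrt (mul_nonneg zero_le_two
        (isDiagonalizableMatrix_iterate_aluthge hT N).normalDefect_nonneg)]
    rw [show n + 1 + N = n + N + 1 by ring, iterate_aluthge_succ, ← Matrix.sub_apply]
    have h1 := norm_apply_sq_le_frobSq (aluthge (aluthge^[n + N] T) - aluthge^[n + N] T) i j
    have h2 := frobSq_aluthge_sub_le (aluthge^[n + N] T)
    have h3 := frobSq_sub_frobSq_aluthge (aluthge^[n + N] T)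
    have h4 := (aluthge_isDiagonalizableMatrix
      (isDiagonalizableMatrix_iterate_aluthge hT (n + N))).normalDefect_nonneg
    linarith [hγ n]
  choose L hL using fun i j => cauchySeq_tendsto_of_complete (hcauchy i j)
  refine ⟨L, (tendsto_add_atTop_iff_nat N).mp ?_⟩
  exact tendsto_pi_nhds.mpr fun i => tendsto_pi_nhds.mpr fun j => hL i j
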